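/- All topological groups are assumed to be Hausdorff. For topological abelian groups $G$ and $H$, an extension of $G$ by $H$ is a short exact sequence $E: 0\to H\xrightarrow{\imath} X\xrightarrow{\pi} G\to 0$ of topological abelian groups in which $\imath$ and $\pi$ are continuous homomorphisms that are open onto their images. Two extensions $E$, $E'$ of $G$ by $H$, with middle groups $X$ and $X'$, are equivalent if there is a continuous homomorphism $T:X\to X'$ with $T\circ\imath=\imath'$ and $\pi'\circ T=\pi$. Let $\mathrm{Ext}(G,H)$ be the set of equivalence classes of extensions of $G$ by $H$; it is an abelian group under the Baer sum $[E_1]+[E_2]=[\nabla_H((E_1\times E_2)\Delta_G)]$, where $\Delta_G(g)=(g,g)$, $\nabla_H(h,h')=h+h'$, and for continuous homomorphisms $t$ into the base (respectively out of the kernel) $Et$ (respectively $tE$) denotes the pull-back (respectively push-out) extension. Let $\varrho G$ be the completion of $G$ and $\mathcal I:G\to\varrho G$ the canonical inclusion. Theorem 3.2. Let $G$ and $H$ be topological abelian groups. If $H$ is \v{C}ech-complete (that is, a $G_\delta$-subset of its Stone--\v{C}ech compactification), then the map $$\phi:\mathrm{Ext}(\varrho G,H)\to \mathrm{Ext}(G,H),\qquad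 [E]\mapsto[E\mathcal I],$$ is an isomorphism of abelian groups. In particular $\mathrm{Ext}(G,H)\cong\mathrm{Ext}(\varrho G,H)$. -/

import Mathlib

open Topology

set_option linter.unusedSectionVars false

universe u v

/-- A topological space is Čech-complete if it is Tychonoff and it is a `G_δ`-subset of its
Stone–Čech compactification. -/
def IsCechComplete (X : Type u) [TopologicalSpace X] : Prop :=
  T35Space X ∧ IsGδ (Set.range (stoneCechUnit : X → StoneCech X))

section Completion

variable (G : Type u) [AddCommGroup G] [TopologicalSpace G] [IsTopologicalAddGroup G]

/-- The completion of a topological abelian group: the (Hausdorff) completion of the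
uniform space given by its canonical group uniformity. -/
def GroupCompletion : Type u :=
  @UniformSpace.Completion G (IsTopologicalAddGroup.rightUniformSpace G)

namespace GroupCompletion

noncomputable instance : AddCommGroup (GroupCompletion G) :=
  letI := IsTopologicalAddGroup.rightUniformSpace G
  haveI := isUniformAddGroup_of_addCommGroup (G := G)
  UniformSpace.Completion.instAddCommGroup (α := G)

noncomputable instance : UniformSpace (GroupCompletion G) :=
  @UniformSpace.Completion.uniformSpace G (IsTopologicalAddGroup.rightUniformSpace G)

instance : IsUniformAddGroup (GroupCompletion G) :=
  letI := IsTopologicalAddGroup.rightUniformSpace G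
  haveI := isUniformAddGroup_of_addCommGroup (G := G)
  UniformSpace.Completion.isUniformAddGroup (α := G)

instance : T2Space (GroupCompletion G) :=
  letI := IsTopologicalAddGroup.rightUniformSpace G
  (inferInstance : T2Space (UniformSpace.Completion G))

instance : CompleteSpace (GroupCompletion G) :=
  @UniformSpace.Completion.completeSpace G (IsTopologicalAddGroup.rightUniformSpace G)

/-- The canonical continuous homomorphism from a topological abelian group to its completion. -/
noncomputable def incl : G →ₜ+ GroupCompletion G :=
  letI := IsTopologicalAddGroup.rightUniformSpace G
  haveI := isUniformAddGroup_of_addCommGroup (G := G)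
  { toAddMonoidHom := (UniformSpace.Completion.toCompl : G →+ UniformSpace.Completion G)
    continuous_toFun := UniformSpace.Completion.continuous_toCompl }

end GroupCompletion

end Completion

/-- An extension `0 → H → X → G → 0` of (Hausdorff) topological abelian groups: a short exact
sequence whose maps are continuous and open onto their images. Since `X` is in bijection with
`H × G`, it may be taken in the universe `max u v`. -/
structure TopExtension (G : Type u) (H : Type v) [AddCommGroup G] [TopologicalSpace G]
    [AddCommGroup H] [TopologicalSpace H] where
  X : Type (max u v)
  [addCommGroup : AddCommGroup X]
  [topologicalSpace : TopologicalSpace X]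
  [isTopologicalAddGroup : IsTopologicalAddGroup X]
  [t2Space : T2Space X]
  ι : H →+ X
  π : X →+ G
  isSES : TopologicalAddGroup.IsSES ι π

attribute [instance] TopExtension.addCommGroup TopExtension.topologicalSpace
  TopExtension.isTopologicalAddGroup TopExtension.t2Space

/-- If the base is Hausdorff, an injective map which is open onto its image automatically has
closed range in a short exact sequence. -/
theorem isSES_of_isInducing {A B C : Type*} [AddCommGroup A] [AddCommGroup B] [AddCommGroup C]
    [TopologicalSpace A] [TopologicalSpace B] [TopologicalSpace C] [T1Space C]
    {i : A →+ B} {p : B →+ C} (hinj : Function.Injective i) (hi : IsInducing i)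
    (hp : IsOpenQuotientMap p) (h : Function.Exact i p) : TopologicalAddGroup.IsSES i p where
  isClosedEmbedding := ⟨⟨hi, hinj⟩, by
    have : Set.range i = p ⁻¹' {0} := by
      ext x; exact (h x).symm
    rw [this]
    exact isClosed_singleton.preimage hp.continuous⟩
  isOpenQuotientMap := hp
  exact := h

/-- The middle group of a short exact sequence with Hausdorff kernel is Hausdorff. -/
theorem t2Space_of_isSES {A B C : Type*} [AddCommGroup A] [AddCommGroup B] [AddCommGroup C]
    [TopologicalSpace A] [TopologicalSpace B] [TopologicalSpace C] [T1Space A]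
    [IsTopologicalAddGroup B]
    {i : A →+ B} {p : B →+ C} (h : TopologicalAddGroup.IsSES i p) : T2Space B := by
  rw [IsTopologicalAddGroup.t2Space_iff_zero_closed]
  have := h.isClosedEmbedding.isClosedMap {0} isClosed_singleton
  simpa using this

namespace TopExtension

section Basic

variable {G : Type u} {H : Type v} [AddCommGroup G] [TopologicalSpace G]
  [AddCommGroup H] [TopologicalSpace H]

/-- Two extensions are equivalent if there is a continuous homomorphism between the middle groups
which commutes with the maps from `H` and to `G`. -/
def Equivalent (E E' : TopExtension G H) : Prop :=
  ∃ T : E.X →ₜ+ E'.X, (∀ h, T (E.ι h) = E'.ι h) ∧ ∀ x, E'.π (T x) = E.π x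

theorem π_ι (E : TopExtension G H) (h : H) : E.π (E.ι h) = 0 :=
  (E.isSES.exact _).2 ⟨h, rfl⟩

theorem exists_ι (E : TopExtension G H) {x : E.X} (hx : E.π x = 0) : ∃ h, E.ι h = x :=
  (E.isSES.exact _).1 hx

theorem ι_injective (E : TopExtension G H) : Function.Injective E.ι :=
  E.isSES.isClosedEmbedding.injective

theorem ι_continuous (E : TopExtension G H) : Continuous E.ι :=
  E.isSES.isClosedEmbedding.continuous

theorem π_continuous (E : TopExtension G H) : Continuous E.π :=
  E.isSES.isOpenQuotientMap.continuous

theorem π_surjective (E : TopExtension G H) : Function.Surjective E.π :=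
  E.isSES.isOpenQuotientMap.surjective

theorem Equivalent.refl (E : TopExtension G H) : E.Equivalent E :=
  ⟨ContinuousAddMonoidHom.id _, fun _ => rfl, fun _ => rfl⟩

theorem Equivalent.trans {E E' E'' : TopExtension G H} (h : E.Equivalent E')
    (h' : E'.Equivalent E'') : E.Equivalent E'' := by
  obtain ⟨T, h1, h2⟩ := h
  obtain ⟨T', h1', h2'⟩ := h'
  refine ⟨T'.comp T, fun h => ?_, fun x => ?_⟩
  · change T' (T _) = _
    rw [h1, h1']
  · change E''.π (T' (T _)) = _
    rw [h2', h2]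

/-- A homomorphism witnessing an equivalence is automatically a topological isomorphism. -/
theorem Equivalent.symm {E E' : TopExtension G H} (h : E.Equivalent E') : E'.Equivalent E := by
  obtain ⟨T, h1, h2⟩ := h
  have hinj : Function.Injective T := by
    rw [injective_iff_map_eq_zero]
    intro x hx
    obtain ⟨h, rfl⟩ := E.exists_ι (x := x) (by rw [← h2, hx, map_zero])
    rw [h1] at hx
    rw [E'.ι_injective (hx.trans (map_zero _).symm), map_zero]
  have hsurj : Function.Surjective T := by
    intro y
    obtain ⟨x, hx⟩ := E.π_surjective (E'.π y)
    obtain ⟨h, hh⟩ := E'.exists_ι (x := y - T x) (by rw [map_sub, h2, hx, sub_self])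
    exact ⟨x + E.ι h, by rw [map_add, h1, hh]; abel⟩
  let e : E.X ≃+ E'.X := AddEquiv.ofBijective (T : E.X →+ E'.X) ⟨hinj, hsurj⟩
  have he : ∀ x, e x = T x := fun _ => rfl
  have hTe : ∀ y, T (e.symm y) = y := fun y => e.apply_symm_apply y
  have hcont : Continuous e.symm := by
    apply continuous_of_continuousAt_zero e.symm
    unfold ContinuousAt
    rw [map_zero]
    intro U hU
    obtain ⟨U₁, hU₁, hadd⟩ := exists_nhds_zero_half hU
    have hi : E.ι ⁻¹' U₁ ∈ 𝓝 (0 : H) :=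
      E.ι_continuous.continuousAt.preimage_mem_nhds (by rwa [map_zero])
    rw [E'.isSES.isClosedEmbedding.isInducing.nhds_eq_comap, map_zero] at hi
    obtain ⟨W, hW, hWU⟩ := hi
    obtain ⟨W₁, hW₁, hsub⟩ := exists_nhds_half_neg hW
    have hN : U₁ ∩ T ⁻¹' W₁ ∈ 𝓝 (0 : E.X) :=
      Filter.inter_mem hU₁ (T.continuous_toFun.continuousAt.preimage_mem_nhds
        (by change W₁ ∈ 𝓝 (T 0); rwa [map_zero]))
    have hN' := E.isSES.isOpenQuotientMap.isOpenMap.image_mem_nhds hN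
    rw [map_zero] at hN'
    have hV : W₁ ∩ E'.π ⁻¹' (E.π '' (U₁ ∩ T ⁻¹' W₁)) ∈ 𝓝 (0 : E'.X) :=
      Filter.inter_mem hW₁ (E'.π_continuous.continuousAt.preimage_mem_nhds
        (by rwa [map_zero]))
    rw [Filter.mem_map]
    refine Filter.mem_of_superset hV ?_
    rintro y ⟨hy, u, ⟨hu, hTu⟩, huy⟩
    obtain ⟨h, hh⟩ := E.exists_ι (x := e.symm y - u)
      (by rw [map_sub, ← h2, hTe, huy, sub_self])
    have : E'.ι h ∈ W := by
      rw [← h1, hh, map_sub, hTe]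
      exact hsub _ hy _ hTu
    have hmem : E.ι h ∈ U₁ := hWU this
    have := hadd _ hu _ hmem
    rw [hh] at this
    simpa using this
  refine ⟨{ toAddMonoidHom := e.symm.toAddMonoidHom, continuous_toFun := hcont },
    fun h => ?_, fun y => ?_⟩
  · change e.symm _ = _
    rw [e.symm_apply_eq, he, h1]
  · change E.π (e.symm y) = _
    rw [← h2, hTe]

variable (G H) in
/-- Equivalence of extensions is an equivalence relation. -/
def setoid : Setoid (TopExtension G H) where
  r := Equivalent
  iseqv := ⟨Equivalent.refl, Equivalent.symm, Equivalent.trans⟩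

end Basic

section Constructions

variable {G : Type u} {H : Type v} [AddCommGroup G] [TopologicalSpace G]
  [AddCommGroup H] [TopologicalSpace H]

section Trivial

variable [IsTopologicalAddGroup G] [T2Space G] [IsTopologicalAddGroup H] [T2Space H]

variable (G H) in
/-- The trivial extension `0 → H → H × G → G → 0`. -/
def trivial : TopExtension G H where
  X := H × G
  ι := AddMonoidHom.inl H G
  π := AddMonoidHom.snd H G
  isSES := by
    refine isSES_of_isInducing (fun a b h => (Prod.ext_iff.1 h).1) ?_
      ⟨Prod.snd_surjective, continuous_snd, isOpenMap_snd⟩ ?_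
    · exact IsInducing.of_comp (g := Prod.fst) (continuous_id.prodMk continuous_const) continuous_fst IsInducing.id
    · rintro ⟨h, g⟩
      constructor
      · rintro rfl
        exact ⟨h, rfl⟩
      · rintro ⟨h', hh⟩
        exact (Prod.ext_iff.1 hh).2.symm

end Trivial

section Neg

/-- The extension with the inclusion of the kernel replaced by its negative. -/
def neg (E : TopExtension G H) : TopExtension G H where
  X := E.X
  ι := -E.ι
  π := E.π
  isSES := by
    refine ⟨?_, E.isSES.isOpenQuotientMap, ?_⟩
    · exact (Homeomorph.neg E.X).isClosedEmbedding.comp E.isSES.isClosedEmbedding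
    · intro x
      constructor
      · intro hx
        obtain ⟨h, rfl⟩ := E.exists_ι hx
        exact ⟨-h, by simp⟩
      · rintro ⟨h, rfl⟩
        simp [E.π_ι]

end Neg

section Pullback

variable {Y : Type u} [AddCommGroup Y] [TopologicalSpace Y]

/-- The subgroup `{(x, y) | π x = t y}` of `X × Y`. -/
def pullbackSubgroup (E : TopExtension G H) (t : Y →ₜ+ G) : AddSubgroup (E.X × Y) :=
  (E.π.comp (AddMonoidHom.fst E.X Y)).eqLocus
    ((t : Y →+ G).comp (AddMonoidHom.snd E.X Y))

theorem mem_pullbackSubgroup {E : TopExtension G H} {t : Y →ₜ+ G} {z : E.X × Y} :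
    z ∈ E.pullbackSubgroup t ↔ E.π z.1 = t z.2 := Iff.rfl

variable [IsTopologicalAddGroup Y] [T2Space Y]

/-- The pull-back extension `E t` of an extension `E` of `G` along `t : Y → G`: its middle group is
`{(x, y) | π x = t y} ⊆ X × Y`. -/
def pullback (E : TopExtension G H) (t : Y →ₜ+ G) : TopExtension Y H where
  X := E.pullbackSubgroup t
  ι := ((AddMonoidHom.inl E.X Y).comp E.ι).codRestrict (E.pullbackSubgroup t)
    (fun h => by rw [mem_pullbackSubgroup]; simp [E.π_ι])
  π := (AddMonoidHom.snd E.X Y).comp (E.pullbackSubgroup t).subtype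
  isSES := by
    refine isSES_of_isInducing ?_ ?_ ⟨?_, ?_, ?_⟩ ?_
    · intro a b h
      exact E.ι_injective (Prod.ext_iff.1 (Subtype.ext_iff.1 h)).1
    · refine IsInducing.of_comp (g := fun z : E.pullbackSubgroup t => z.1.1) ?_ (by fun_prop)
        E.isSES.isClosedEmbedding.isInducing
      refine Continuous.subtype_mk (f := fun h => ((E.ι h, 0) : E.X × Y)) ?_ _
      exact E.ι_continuous.prodMk continuous_const
    · intro y
      obtain ⟨x, hx⟩ := E.π_surjective (t y)
      exact ⟨⟨(x, y), hx⟩, rfl⟩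
    · exact continuous_snd.comp continuous_subtype_val
    · apply IsTopologicalAddGroup.isOpenMap_iff_nhds_zero.2
      intro S hS
      rw [Filter.mem_map] at hS
      obtain ⟨V, hV, hVS⟩ := mem_nhds_subtype _ _ _ |>.1 hS
      change V ∈ 𝓝 ((0 : E.X), (0 : Y)) at hV
      rw [nhds_prod_eq, Filter.mem_prod_iff] at hV
      obtain ⟨A, hA, B, hB, hAB⟩ := hV
      have hA' := E.isSES.isOpenQuotientMap.isOpenMap.image_mem_nhds hA
      rw [map_zero] at hA'
      have hA'' : t ⁻¹' (E.π '' A) ∈ 𝓝 (0 : Y) :=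
        t.continuous_toFun.continuousAt.preimage_mem_nhds
          (by change _ ∈ 𝓝 (t 0); rwa [map_zero])
      refine Filter.mem_of_superset (Filter.inter_mem hA'' hB) ?_
      rintro y ⟨⟨a, ha, hay⟩, hy⟩
      exact hVS (a := ⟨(a, y), hay⟩) (hAB ⟨ha, hy⟩)
    · rintro ⟨⟨x, y⟩, hxy⟩
      rw [mem_pullbackSubgroup] at hxy
      constructor
      · intro hy
        change y = 0 at hy
        subst hy
        obtain ⟨h, rfl⟩ := E.exists_ι (x := x) (by simpa using hxy)
        exact ⟨h, rfl⟩
      · rintro ⟨h, hh⟩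
        exact (Prod.ext_iff.1 (Subtype.ext_iff.1 hh)).2.symm

/-- An extension of `Y` which maps to `E` over `t` and under `H` is the pull-back of `E`. -/
theorem equivalent_pullback {E : TopExtension G H} {t : Y →ₜ+ G} {F : TopExtension Y H}
    (T : F.X →ₜ+ E.X) (h1 : ∀ h, T (F.ι h) = E.ι h) (h2 : ∀ x, E.π (T x) = t (F.π x)) :
    F.Equivalent (E.pullback t) := by
  refine ⟨{ toAddMonoidHom := ((T : F.X →+ E.X).prod F.π).codRestrict
              (E.pullbackSubgroup t) h2
            continuous_toFun := ?_ }, ?_, ?_⟩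
  · exact Continuous.subtype_mk (T.continuous_toFun.prodMk F.π_continuous) _
  · intro h
    exact Subtype.ext (Prod.ext (h1 h) (F.π_ι h))
  · intro x
    rfl

theorem Equivalent.pullback {E E' : TopExtension G H} (h : E.Equivalent E') (t : Y →ₜ+ G) :
    (E.pullback t).Equivalent (E'.pullback t) := by
  obtain ⟨T, h1, h2⟩ := h
  refine equivalent_pullback
    (T.comp { toAddMonoidHom := (AddMonoidHom.fst E.X Y).comp (E.pullbackSubgroup t).subtype
              continuous_toFun := continuous_fst.comp continuous_subtype_val }) ?_ ?_
  · intro h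
    exact h1 h
  · intro x
    exact (h2 _).trans x.2

end Pullback

section Pushout

variable [T2Space G] {Y : Type v} [AddCommGroup Y] [TopologicalSpace Y] [IsTopologicalAddGroup Y]

/-- The subgroup `{(t h, -ι h) | h ∈ H}` of `Y × X`. -/
def pushoutSubgroup (E : TopExtension G H) (t : H →ₜ+ Y) : AddSubgroup (Y × E.X) :=
  ((t : H →+ Y).prod (-E.ι)).range

/-- The projection of the push-out to the base. -/
def pushoutπ (E : TopExtension G H) (t : H →ₜ+ Y) : (Y × E.X) ⧸ E.pushoutSubgroup t →+ G :=
  QuotientAddGroup.lift (E.pushoutSubgroup t) (E.π.comp (AddMonoidHom.snd Y E.X)) (by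
    rintro _ ⟨h, rfl⟩
    simp [E.π_ι])

/-- The inclusion of the kernel in the push-out. -/
def pushoutι (E : TopExtension G H) (t : H →ₜ+ Y) : Y →+ (Y × E.X) ⧸ E.pushoutSubgroup t :=
  (QuotientAddGroup.mk' (E.pushoutSubgroup t)).comp (AddMonoidHom.inl Y E.X)

theorem pushout_isSES (E : TopExtension G H) (t : H →ₜ+ Y) :
    TopologicalAddGroup.IsSES (E.pushoutι t) (E.pushoutπ t) := by
  have hker : ∀ y : Y, ∀ z : Y × E.X,
      E.pushoutι t y = (QuotientAddGroup.mk z : (Y × E.X) ⧸ E.pushoutSubgroup t) →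
      ∃ h, y = z.1 + t h ∧ z.2 = E.ι h := by
    intro y z h
    obtain ⟨k, hk⟩ := QuotientAddGroup.eq.1 h
    have e1 : t k = -y + z.1 := (Prod.ext_iff.1 hk).1
    have e2 : -E.ι k = -0 + z.2 := (Prod.ext_iff.1 hk).2
    refine ⟨-k, ?_, ?_⟩
    · rw [map_neg, e1]; abel
    · rw [map_neg, e2]; abel
  have hcont : Continuous (E.pushoutι t) :=
    QuotientAddGroup.continuous_mk.comp (continuous_id.prodMk continuous_const)
  refine isSES_of_isInducing ?_ ?_ ?_ ?_
  · rw [injective_iff_map_eq_zero]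
    intro y hy
    obtain ⟨h, h1, h2⟩ := hker y 0 hy
    have : h = 0 := E.ι_injective (h2.symm.trans (map_zero _).symm)
    simpa [this] using h1
  · apply IsTopologicalAddGroup.isInducing_iff_nhds_zero.2
    apply le_antisymm
    · have := hcont.tendsto 0
      rw [map_zero] at this
      exact this.le_comap
    · intro U hU
      obtain ⟨U₁, hU₁, hadd⟩ := exists_nhds_zero_half hU
      have ht : t ⁻¹' U₁ ∈ 𝓝 (0 : H) :=
        t.continuous_toFun.continuousAt.preimage_mem_nhds
          (by change _ ∈ 𝓝 (t 0); rwa [map_zero])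
      rw [E.isSES.isClosedEmbedding.isInducing.nhds_eq_comap, map_zero] at ht
      obtain ⟨W, hW, hWU⟩ := ht
      have hprod : U₁ ×ˢ W ∈ 𝓝 (0 : Y × E.X) := prod_mem_nhds hU₁ hW
      refine ⟨_, QuotientAddGroup.isOpenMap_coe.image_mem_nhds hprod, ?_⟩
      rintro y ⟨z, ⟨hz1, hz2⟩, hz⟩
      obtain ⟨h, rfl, h2⟩ := hker y z hz.symm
      exact hadd _ hz1 _ (hWU (by rwa [Set.mem_preimage, ← h2]))
  · have hq : IsOpenQuotientMap (QuotientAddGroup.mk : Y × E.X → _ ⧸ E.pushoutSubgroup t) :=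
      QuotientAddGroup.isOpenQuotientMap_mk
    have hsnd : IsOpenQuotientMap (Prod.snd : Y × E.X → E.X) :=
      ⟨Prod.snd_surjective, continuous_snd, isOpenMap_snd⟩
    exact (IsOpenQuotientMap.of_comp_iff hq).1 (E.isSES.isOpenQuotientMap.comp hsnd)
  · intro q
    obtain ⟨⟨y, x⟩, rfl⟩ := QuotientAddGroup.mk_surjective q
    constructor
    · intro hx
      obtain ⟨h, rfl⟩ := E.exists_ι (x := x) hx
      refine ⟨y + t h, ?_⟩
      refine QuotientAddGroup.eq.2 ⟨-h, ?_⟩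
      refine Prod.ext ?_ ?_
      · change t (-h) = -(y + t h) + y
        rw [map_neg]; abel
      · change -E.ι (-h) = -0 + E.ι h
        rw [map_neg]; abel
    · rintro ⟨y', hy'⟩
      rw [← hy']
      exact map_zero E.π

variable [T2Space Y]

/-- The push-out extension `t E` of an extension `E` by `H` along `t : H → Y`: its middle group is
the quotient of `Y × X` by `{(t h, -ι h) | h ∈ H}`. -/
def pushout (E : TopExtension G H) (t : H →ₜ+ Y) : TopExtension G Y :=
  haveI := t2Space_of_isSES (E.pushout_isSES t)
  { X := (Y × E.X) ⧸ E.pushoutSubgroup t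
    ι := E.pushoutι t
    π := E.pushoutπ t
    isSES := E.pushout_isSES t }

/-- The canonical map from the middle group of an extension to that of its push-out. -/
def toPushout (E : TopExtension G H) (t : H →ₜ+ Y) : E.X →ₜ+ (E.pushout t).X where
  toAddMonoidHom := (QuotientAddGroup.mk' (E.pushoutSubgroup t)).comp (AddMonoidHom.inr Y E.X)
  continuous_toFun := QuotientAddGroup.continuous_mk.comp (continuous_const.prodMk continuous_id)

theorem toPushout_ι (E : TopExtension G H) (t : H →ₜ+ Y) (h : H) :
    E.toPushout t (E.ι h) = (E.pushout t).ι (t h) := by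
  refine QuotientAddGroup.eq.2 ⟨h, ?_⟩
  refine Prod.ext ?_ ?_
  · change t h = -0 + t h
    abel
  · change -E.ι h = -E.ι h + 0
    abel

theorem π_toPushout (E : TopExtension G H) (t : H →ₜ+ Y) (x : E.X) :
    (E.pushout t).π (E.toPushout t x) = E.π x := rfl

/-- An extension by `Y` to which `E` maps under `t` and over `G` is the push-out of `E`. -/
theorem pushout_equivalent {E : TopExtension G H} {t : H →ₜ+ Y} {F : TopExtension G Y}
    (T : E.X →ₜ+ F.X) (h1 : ∀ h, T (E.ι h) = F.ι (t h)) (h2 : ∀ x, F.π (T x) = E.π x) :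
    (E.pushout t).Equivalent F := by
  let f : Y × E.X →+ F.X := F.ι.coprod (T : E.X →+ F.X)
  have hf : Continuous f :=
    (F.ι_continuous.comp continuous_fst).add (T.continuous_toFun.comp continuous_snd)
  have hker : E.pushoutSubgroup t ≤ f.ker := by
    rintro _ ⟨h, rfl⟩
    change F.ι (t h) + T (-E.ι h) = 0
    rw [map_neg, h1, add_neg_cancel]
  refine ⟨{ toAddMonoidHom := QuotientAddGroup.lift (E.pushoutSubgroup t) f hker
            continuous_toFun := hf.quotient_lift _ }, ?_, ?_⟩
  · intro y
    change F.ι y + T 0 = F.ι y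
    rw [map_zero, add_zero]
  · intro q
    obtain ⟨⟨y, x⟩, rfl⟩ := QuotientAddGroup.mk_surjective q
    change F.π (F.ι y + T x) = E.π x
    rw [map_add, F.π_ι, h2, zero_add]

theorem Equivalent.pushout {E E' : TopExtension G H} (h : E.Equivalent E') (t : H →ₜ+ Y) :
    (E.pushout t).Equivalent (E'.pushout t) := by
  obtain ⟨T, h1, h2⟩ := h
  refine pushout_equivalent ((E'.toPushout t).comp T) ?_ ?_
  · intro h
    change E'.toPushout t (T (E.ι h)) = _
    rw [h1, toPushout_ι]
  · intro x
    exact h2 x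

end Pushout

section Prod

variable {G' : Type u} {H' : Type v} [AddCommGroup G'] [TopologicalSpace G']
  [AddCommGroup H'] [TopologicalSpace H']

/-- The product of two extensions. -/
def prod (E : TopExtension G H) (E' : TopExtension G' H') : TopExtension (G × G') (H × H') where
  X := E.X × E'.X
  ι := E.ι.prodMap E'.ι
  π := E.π.prodMap E'.π
  isSES := by
    refine ⟨?_, E.isSES.isOpenQuotientMap.prodMap E'.isSES.isOpenQuotientMap, ?_⟩
    · exact E.isSES.isClosedEmbedding.prodMap E'.isSES.isClosedEmbedding
    · rintro ⟨x, x'⟩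
      constructor
      · intro hx
        obtain ⟨h, rfl⟩ := E.exists_ι (Prod.ext_iff.1 hx).1
        obtain ⟨h', rfl⟩ := E'.exists_ι (Prod.ext_iff.1 hx).2
        exact ⟨(h, h'), rfl⟩
      · rintro ⟨⟨h, h'⟩, hh⟩
        rw [← hh]
        exact Prod.ext (E.π_ι h) (E'.π_ι h')

theorem Equivalent.prod {E F : TopExtension G H} {E' F' : TopExtension G' H'}
    (h : E.Equivalent F) (h' : E'.Equivalent F') : (E.prod E').Equivalent (F.prod F') := by
  obtain ⟨T, h1, h2⟩ := h
  obtain ⟨T', h1', h2'⟩ := h'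
  refine ⟨{ toAddMonoidHom := (T : E.X →+ F.X).prodMap (T' : E'.X →+ F'.X)
            continuous_toFun := T.continuous_toFun.prodMap T'.continuous_toFun }, ?_, ?_⟩
  · rintro ⟨h, h'⟩
    exact Prod.ext (h1 h) (h1' h')
  · rintro ⟨x, x'⟩
    exact Prod.ext (h2 x) (h2' x')

end Prod

end Constructions

section Baer

variable {G : Type u} {H : Type v} [AddCommGroup G] [TopologicalSpace G]
  [IsTopologicalAddGroup G] [T2Space G]
  [AddCommGroup H] [TopologicalSpace H] [IsTopologicalAddGroup H] [T2Space H]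

variable (G) in
/-- The diagonal map `g ↦ (g, g)`. -/
def diagonal : G →ₜ+ G × G where
  toAddMonoidHom := (AddMonoidHom.id G).prod (AddMonoidHom.id G)
  continuous_toFun := continuous_id.prodMk continuous_id

variable (H) in
/-- The codiagonal map `(h, h') ↦ h + h'`. -/
def codiagonal : H × H →ₜ+ H where
  toAddMonoidHom := (AddMonoidHom.id H).coprod (AddMonoidHom.id H)
  continuous_toFun := continuous_fst.add continuous_snd

/-- The Baer sum `∇ ((E₁ × E₂) Δ)` of two extensions. -/
def baerSum (E₁ E₂ : TopExtension G H) : TopExtension G H :=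
  ((E₁.prod E₂).pullback (diagonal G)).pushout (codiagonal H)

theorem Equivalent.baerSum {E₁ F₁ E₂ F₂ : TopExtension G H} (h₁ : E₁.Equivalent F₁)
    (h₂ : E₂.Equivalent F₂) : (E₁.baerSum E₂).Equivalent (F₁.baerSum F₂) :=
  ((h₁.prod h₂).pullback _).pushout _

/-- The extension `(E₁ × E₂) Δ` of `G` by `H × H`. -/
def fiberProd (E₁ E₂ : TopExtension G H) : TopExtension G (H × H) :=
  (E₁.prod E₂).pullback (diagonal G)

/-- The first projection of the fiber product. -/
def fiberFst (E₁ E₂ : TopExtension G H) : (E₁.fiberProd E₂).X →ₜ+ E₁.X where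
  toAddMonoidHom := (AddMonoidHom.fst E₁.X E₂.X).comp ((AddMonoidHom.fst (E₁.X × E₂.X) G).comp
    ((E₁.prod E₂).pullbackSubgroup (diagonal G)).subtype)
  continuous_toFun := continuous_fst.comp (continuous_fst.comp continuous_subtype_val)

/-- The second projection of the fiber product. -/
def fiberSnd (E₁ E₂ : TopExtension G H) : (E₁.fiberProd E₂).X →ₜ+ E₂.X where
  toAddMonoidHom := (AddMonoidHom.snd E₁.X E₂.X).comp ((AddMonoidHom.fst (E₁.X × E₂.X) G).comp
    ((E₁.prod E₂).pullbackSubgroup (diagonal G)).subtype)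
  continuous_toFun := continuous_snd.comp (continuous_fst.comp continuous_subtype_val)

theorem π_fiberFst {E₁ E₂ : TopExtension G H} (x : (E₁.fiberProd E₂).X) :
    E₁.π (fiberFst E₁ E₂ x) = (E₁.fiberProd E₂).π x :=
  (Prod.ext_iff.1 x.2).1

theorem π_fiberSnd {E₁ E₂ : TopExtension G H} (x : (E₁.fiberProd E₂).X) :
    E₂.π (fiberSnd E₁ E₂ x) = (E₁.fiberProd E₂).π x :=
  (Prod.ext_iff.1 x.2).2

/-- Continuous homomorphisms into the fiber product. -/
def fiberLift {E₁ E₂ : TopExtension G H} {A : Type*} [AddCommGroup A] [TopologicalSpace A]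
    (f₁ : A →ₜ+ E₁.X) (f₂ : A →ₜ+ E₂.X) (h : ∀ a, E₂.π (f₂ a) = E₁.π (f₁ a)) :
    A →ₜ+ (E₁.fiberProd E₂).X where
  toAddMonoidHom := (((f₁ : A →+ E₁.X).prod (f₂ : A →+ E₂.X)).prod
    (E₁.π.comp (f₁ : A →+ E₁.X))).codRestrict ((E₁.prod E₂).pullbackSubgroup (diagonal G))
      (fun a => Prod.ext rfl (h a))
  continuous_toFun := Continuous.subtype_mk ((f₁.continuous_toFun.prodMk f₂.continuous_toFun).prodMk
    (E₁.π_continuous.comp f₁.continuous_toFun)) _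

theorem fiberLift_eq_ι {E₁ E₂ : TopExtension G H} {A : Type*} [AddCommGroup A]
    [TopologicalSpace A] {f₁ : A →ₜ+ E₁.X} {f₂ : A →ₜ+ E₂.X}
    {h : ∀ a, E₂.π (f₂ a) = E₁.π (f₁ a)} {a : A} {h₁ h₂ : H}
    (e₁ : f₁ a = E₁.ι h₁) (e₂ : f₂ a = E₂.ι h₂) :
    fiberLift f₁ f₂ h a = (E₁.fiberProd E₂).ι (h₁, h₂) := by
  refine Subtype.ext (Prod.ext (Prod.ext e₁ e₂) ?_)
  change E₁.π (f₁ a) = 0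
  rw [e₁, E₁.π_ι]

/-- The canonical map from the fiber product to the Baer sum. -/
def toBaerSum (E₁ E₂ : TopExtension G H) : (E₁.fiberProd E₂).X →ₜ+ (E₁.baerSum E₂).X :=
  (E₁.fiberProd E₂).toPushout (codiagonal H)

theorem toBaerSum_ι (E₁ E₂ : TopExtension G H) (h₁ h₂ : H) :
    toBaerSum E₁ E₂ ((E₁.fiberProd E₂).ι (h₁, h₂)) = (E₁.baerSum E₂).ι (h₁ + h₂) :=
  (E₁.fiberProd E₂).toPushout_ι (codiagonal H) (h₁, h₂)

theorem π_toBaerSum (E₁ E₂ : TopExtension G H) (x : (E₁.fiberProd E₂).X) :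
    (E₁.baerSum E₂).π (toBaerSum E₁ E₂ x) = (E₁.fiberProd E₂).π x := rfl

theorem baerSum_equivalent {E₁ E₂ F : TopExtension G H} (T : (E₁.fiberProd E₂).X →ₜ+ F.X)
    (h1 : ∀ h₁ h₂, T ((E₁.fiberProd E₂).ι (h₁, h₂)) = F.ι (h₁ + h₂))
    (h2 : ∀ x, F.π (T x) = (E₁.fiberProd E₂).π x) : (E₁.baerSum E₂).Equivalent F :=
  pushout_equivalent (t := codiagonal H) T (fun h => h1 h.1 h.2) h2

theorem baerSum_comm (E₁ E₂ : TopExtension G H) :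
    (E₁.baerSum E₂).Equivalent (E₂.baerSum E₁) := by
  refine baerSum_equivalent ((toBaerSum E₂ E₁).comp
    (fiberLift (fiberSnd E₁ E₂) (fiberFst E₁ E₂) fun x => by rw [π_fiberFst, π_fiberSnd])) ?_ ?_
  · intro h₁ h₂
    change toBaerSum E₂ E₁ (fiberLift _ _ _ _) = _
    rw [fiberLift_eq_ι (h₁ := h₂) (h₂ := h₁) rfl rfl, toBaerSum_ι, add_comm]
  · intro x
    exact π_fiberSnd x

theorem baerSum_trivial (E : TopExtension G H) :
    (E.baerSum (trivial G H)).Equivalent E := by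
  let q₁ : (E.fiberProd (trivial G H)).X →ₜ+ E.X := fiberFst E (trivial G H)
  let q₂ : (E.fiberProd (trivial G H)).X →ₜ+ H × G := fiberSnd E (trivial G H)
  refine baerSum_equivalent
    { toAddMonoidHom := (q₁ : _ →+ E.X) + E.ι.comp ((AddMonoidHom.fst H G).comp (q₂ : _ →+ H × G))
      continuous_toFun := q₁.continuous_toFun.add
        (E.ι_continuous.comp (continuous_fst.comp q₂.continuous_toFun)) } ?_ ?_
  · intro h₁ h₂
    exact (map_add E.ι h₁ h₂).symm
  · intro x
    change E.π (fiberFst E (trivial G H) x + E.ι _) = _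
    rw [map_add, E.π_ι, add_zero, π_fiberFst]

theorem neg_baerSum (E : TopExtension G H) :
    (E.neg.baerSum E).Equivalent (trivial G H) := by
  let P := E.neg.fiberProd E
  let q₁ : P.X →ₜ+ E.X := fiberFst E.neg E
  let q₂ : P.X →ₜ+ E.X := fiberSnd E.neg E
  let d : P.X →+ E.X := (q₂ : P.X →+ E.X) - (q₁ : P.X →+ E.X)
  have hd : Continuous d := q₂.continuous_toFun.sub q₁.continuous_toFun
  have hd0 : ∀ x, E.π (d x) = 0 := by
    intro x
    change E.π (q₂ x - q₁ x) = 0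
    rw [map_sub, sub_eq_zero]
    exact (π_fiberSnd x).trans (π_fiberFst (E₁ := E.neg) x).symm
  choose k hk using fun x => E.exists_ι (hd0 x)
  have hkc : Continuous k := by
    rw [E.isSES.isClosedEmbedding.isInducing.continuous_iff]
    exact hd.congr fun x => (hk x).symm
  let k' : P.X →+ H :=
    AddMonoidHom.mk' k fun a b => E.ι_injective (by rw [map_add, hk, hk, hk, map_add])
  refine baerSum_equivalent
    { toAddMonoidHom := k'.prod P.π
      continuous_toFun := hkc.prodMk P.π_continuous } ?_ ?_
  · intro h₁ h₂
    refine Prod.ext (E.ι_injective ((hk _).trans ?_)) (P.π_ι (h₁, h₂))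
    change E.ι h₂ - -E.ι h₁ = E.ι (h₁ + h₂)
    rw [map_add]; abel
  · intro x
    rfl

theorem baerSum_assoc (E₁ E₂ E₃ : TopExtension G H) :
    ((E₁.baerSum E₂).baerSum E₃).Equivalent (E₁.baerSum (E₂.baerSum E₃)) := by
  let Δ : G →ₜ+ (G × G) × G :=
    { toAddMonoidHom := ((AddMonoidHom.id G).prod (AddMonoidHom.id G)).prod (AddMonoidHom.id G)
      continuous_toFun := (continuous_id.prodMk continuous_id).prodMk continuous_id }
  let c : (H × H) × H →ₜ+ H :=
    { toAddMonoidHom :=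
        ((AddMonoidHom.id H).coprod (AddMonoidHom.id H)).coprod (AddMonoidHom.id H)
      continuous_toFun := ((continuous_fst.comp continuous_fst).add
        (continuous_snd.comp continuous_fst)).add continuous_snd }
  let P : TopExtension G ((H × H) × H) := ((E₁.prod E₂).prod E₃).pullback Δ
  let j : P.X →ₜ+ (E₁.X × E₂.X) × E₃.X :=
    { toAddMonoidHom := (AddMonoidHom.fst ((E₁.X × E₂.X) × E₃.X) G).comp
        (((E₁.prod E₂).prod E₃).pullbackSubgroup Δ).subtype
      continuous_toFun := continuous_fst.comp continuous_subtype_val }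
  let p₁ : P.X →ₜ+ E₁.X :=
    { toAddMonoidHom := (AddMonoidHom.fst E₁.X E₂.X).comp
        ((AddMonoidHom.fst (E₁.X × E₂.X) E₃.X).comp (j : P.X →+ _))
      continuous_toFun := continuous_fst.comp (continuous_fst.comp j.continuous_toFun) }
  let p₂ : P.X →ₜ+ E₂.X :=
    { toAddMonoidHom := (AddMonoidHom.snd E₁.X E₂.X).comp
        ((AddMonoidHom.fst (E₁.X × E₂.X) E₃.X).comp (j : P.X →+ _))
      continuous_toFun := continuous_snd.comp (continuous_fst.comp j.continuous_toFun) }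
  let p₃ : P.X →ₜ+ E₃.X :=
    { toAddMonoidHom := (AddMonoidHom.snd (E₁.X × E₂.X) E₃.X).comp (j : P.X →+ _)
      continuous_toFun := continuous_snd.comp j.continuous_toFun }
  have hp₁ : ∀ x, E₁.π (p₁ x) = P.π x := fun x => (Prod.ext_iff.1 (Prod.ext_iff.1 x.2).1).1
  have hp₂ : ∀ x, E₂.π (p₂ x) = P.π x := fun x => (Prod.ext_iff.1 (Prod.ext_iff.1 x.2).1).2
  have hp₃ : ∀ x, E₃.π (p₃ x) = P.π x := fun x => (Prod.ext_iff.1 x.2).2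
  let f₁₂ : P.X →ₜ+ (E₁.baerSum E₂).X :=
    (toBaerSum E₁ E₂).comp (fiberLift p₁ p₂ fun x => (hp₂ x).trans (hp₁ x).symm)
  let f₂₃ : P.X →ₜ+ (E₂.baerSum E₃).X :=
    (toBaerSum E₂ E₃).comp (fiberLift p₂ p₃ fun x => (hp₃ x).trans (hp₂ x).symm)
  have h₁₂ : ∀ a b d, f₁₂ (P.ι ((a, b), d)) = (E₁.baerSum E₂).ι (a + b) := by
    intro a b d
    change toBaerSum E₁ E₂ (fiberLift _ _ _ _) = _
    rw [fiberLift_eq_ι (h₁ := a) (h₂ := b) rfl rfl, toBaerSum_ι]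
  have h₂₃ : ∀ a b d, f₂₃ (P.ι ((a, b), d)) = (E₂.baerSum E₃).ι (b + d) := by
    intro a b d
    change toBaerSum E₂ E₃ (fiberLift _ _ _ _) = _
    rw [fiberLift_eq_ι (h₁ := b) (h₂ := d) rfl rfl, toBaerSum_ι]
  have hπ₁₂ : ∀ x, (E₁.baerSum E₂).π (f₁₂ x) = P.π x := hp₁
  have hπ₂₃ : ∀ x, (E₂.baerSum E₃).π (f₂₃ x) = P.π x := hp₂
  have A : (P.pushout c).Equivalent ((E₁.baerSum E₂).baerSum E₃) := by
    refine pushout_equivalent ((toBaerSum _ _).comp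
      (fiberLift f₁₂ p₃ fun x => (hp₃ x).trans (hπ₁₂ x).symm)) ?_ hπ₁₂
    rintro ⟨⟨a, b⟩, d⟩
    change toBaerSum _ _ (fiberLift _ _ _ _) = _
    rw [fiberLift_eq_ι (h₁ := a + b) (h₂ := d) (h₁₂ a b d) rfl, toBaerSum_ι]
    rfl
  have B : (P.pushout c).Equivalent (E₁.baerSum (E₂.baerSum E₃)) := by
    refine pushout_equivalent ((toBaerSum _ _).comp
      (fiberLift p₁ f₂₃ fun x => (hπ₂₃ x).trans (hp₁ x).symm)) ?_ hp₁
    rintro ⟨⟨a, b⟩, d⟩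
    change toBaerSum _ _ (fiberLift _ _ _ _) = _
    rw [fiberLift_eq_ι (h₁ := a) (h₂ := b + d) rfl (h₂₃ a b d), toBaerSum_ι, ← add_assoc]
    rfl
  exact A.symm.trans B

theorem Equivalent.neg {E F : TopExtension G H} (h : E.Equivalent F) :
    E.neg.Equivalent F.neg := by
  obtain ⟨T, h1, h2⟩ := h
  refine ⟨T, fun h => ?_, h2⟩
  change T (-E.ι h) = -F.ι h
  rw [map_neg, h1]

end Baer

end TopExtension

section Ext

variable (G : Type u) (H : Type v) [AddCommGroup G] [TopologicalSpace G]
  [AddCommGroup H] [TopologicalSpace H]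

/-- `Ext(G, H)`: the set of equivalence classes of extensions `0 → H → X → G → 0` of topological
abelian groups. -/
def TopExt : Type (max u v + 1) :=
  Quotient (TopExtension.setoid G H)

end Ext

namespace TopExt

open TopExtension

section

variable {G : Type u} {H : Type v} [AddCommGroup G] [TopologicalSpace G]
  [AddCommGroup H] [TopologicalSpace H]

/-- The class of an extension. -/
def mk (E : TopExtension G H) : TopExt G H :=
  Quotient.mk (TopExtension.setoid G H) E

theorem mk_eq_mk {E F : TopExtension G H} : mk E = mk F ↔ E.Equivalent F :=
  Quotient.eq (r := TopExtension.setoid G H)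

theorem ind {p : TopExt G H → Prop} (h : ∀ E, p (mk E)) (e : TopExt G H) : p e :=
  Quotient.ind h e

/-- The map `[E] ↦ [E t]` induced by pull-back along `t : Y → G`. -/
def pullback {Y : Type u} [AddCommGroup Y] [TopologicalSpace Y] [IsTopologicalAddGroup Y]
    [T2Space Y] (t : Y →ₜ+ G) : TopExt G H → TopExt Y H :=
  Quotient.map (fun E => E.pullback t) (fun _ _ h => Equivalent.pullback h t)

end

variable {G : Type u} {H : Type v} [AddCommGroup G] [TopologicalSpace G]
  [IsTopologicalAddGroup G] [T2Space G]
  [AddCommGroup H] [TopologicalSpace H] [IsTopologicalAddGroup H] [T2Space H]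

/-- Zero in `Ext(G, H)` is the class of the trivial extension. -/
instance : Zero (TopExt G H) := ⟨mk (TopExtension.trivial G H)⟩

/-- Addition in `Ext(G, H)` is induced by the Baer sum. -/
instance : Add (TopExt G H) :=
  ⟨Quotient.map₂ baerSum (fun _ _ h₁ _ _ h₂ => Equivalent.baerSum h₁ h₂)⟩

instance : Neg (TopExt G H) :=
  ⟨Quotient.map TopExtension.neg (fun _ _ h => Equivalent.neg h)⟩

theorem mk_add_mk (E F : TopExtension G H) : mk E + mk F = mk (E.baerSum F) := rfl

/-- `Ext(G, H)` is an abelian group. -/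
instance : AddCommGroup (TopExt G H) where
  nsmul := nsmulRec
  zsmul := zsmulRec
  add_assoc := by
    intro a b c
    induction a using ind with | _ E₁
    induction b using ind with | _ E₂
    induction c using ind with | _ E₃
    exact mk_eq_mk.2 (baerSum_assoc E₁ E₂ E₃)
  add_comm := by
    intro a b
    induction a using ind with | _ E₁
    induction b using ind with | _ E₂
    exact mk_eq_mk.2 (baerSum_comm E₁ E₂)
  add_zero := by
    intro a
    induction a using ind with | _ E
    exact mk_eq_mk.2 (baerSum_trivial E)
  zero_add := by
    intro a
    induction a using ind with | _ E
    exact mk_eq_mk.2 ((baerSum_comm _ E).trans (baerSum_trivial E))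
  neg_add_cancel := by
    intro a
    induction a using ind with | _ E
    exact mk_eq_mk.2 (neg_baerSum E)

end TopExt

/-! Pulling back commutes with Baer sums, so `φ` is a homomorphism (`baerSum_pullback`). The other
two points use two consequences of Čech-completeness: `H` is complete, and `H` is feathered.

Injectivity uses completeness. The middle group of the pull-back of `E` along the inclusion is a
dense subgroup of `E.X` containing `H`. If the pull-back splits, its retraction onto `H` extends by
continuity to `E.X` because `H` is complete, so `E` splits (`equivalent_trivial_of_pullback`).

Surjectivity is obtained by completing the middle group `X` of an extension of `G`. Completeness
makes `H` closed in the completion of `X`. The quotient by `H` contains `G` as a dense subgroup, so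
it is the completion of `G` once it is known to be complete. Quotients of complete groups can fail
to be complete; here `completeSpace_quotient_of_isFeathered` applies: a Cauchy filter on the
quotient is lifted along countably many neighbourhoods, and the remaining freedom, lying in `H`, is
totally bounded in the limit, so an ultrafilter finer than the lift is Cauchy.

Both properties of `H` come from its Stone–Čech compactification: ultrafilters confined to suitable
neighbourhoods of zero converge in `H`, which gives featheredness, while a Baire category argument
in the completion gives completeness. -/

open Filter Set Pointwise

/-! ### Cauchy filters in abelian groups -/

section Cauchy

variable {Y : Type*} [AddCommGroup Y] [UniformSpace Y] [IsUniformAddGroup Y]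

theorem cauchy_iff_exists_sub_mem {f : Filter Y} :
    Cauchy f ↔ f.NeBot ∧ ∀ U ∈ 𝓝 (0 : Y), ∃ S ∈ f, ∀ x ∈ S, ∀ y ∈ S, y - x ∈ U := by
  rw [((𝓝 (0 : Y)).basis_sets.uniformity_of_nhds_zero).cauchy_iff]
  rfl

/-- Two points of one translate of a half of `U` differ by an element of `U`. This form suits an
ultrafilter that picks one translate out of a finite cover. -/
theorem cauchy_of_exists_translate_mem {f : Filter Y} [f.NeBot]
    (h : ∀ U ∈ 𝓝 (0 : Y), ∃ x, {y | y - x ∈ U} ∈ f) : Cauchy f := by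
  refine cauchy_iff_exists_sub_mem.2 ⟨inferInstance, fun U hU => ?_⟩
  obtain ⟨W, hW, hsub⟩ := exists_nhds_half_neg hU
  obtain ⟨x, hx⟩ := h W hW
  refine ⟨_, hx, fun a ha b hb => ?_⟩
  simpa using hsub _ hb _ ha

end Cauchy

/-- A topological abelian group is *feathered* if it has a sequence of neighbourhoods of zero
that are eventually covered by finitely many translates of any given neighbourhood of zero. -/
def IsFeathered (H : Type*) [AddCommGroup H] [TopologicalSpace H] : Prop :=
  ∃ V : ℕ → Set H, (∀ n, V n ∈ 𝓝 0) ∧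
    ∀ U ∈ 𝓝 (0 : H), ∃ n, ∃ A : Set H, A.Finite ∧ ∀ x ∈ V n, ∃ a ∈ A, x - a ∈ U

/-! ### Completeness of quotients by feathered subgroups -/

section Quotient

variable {H Y : Type*} [AddCommGroup H] [TopologicalSpace H]
  [AddCommGroup Y] [UniformSpace Y] [IsUniformAddGroup Y]

/-- A sequence of symmetric neighbourhoods of zero, each containing the double of the next and
refining a prescribed sequence. -/
theorem exists_nhds_zero_seq_add_subset (P : ℕ → Set Y) (hP : ∀ n, P n ∈ 𝓝 0) :
    ∃ W : ℕ → Set Y, (∀ n, W n ∈ 𝓝 0) ∧ (∀ n, W n ⊆ P n) ∧ (∀ n, ∀ x ∈ W n, -x ∈ W n) ∧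
      ∀ n, ∀ x ∈ W (n + 1), ∀ y ∈ W (n + 1), x + y ∈ W n := by
  have step : ∀ (n : ℕ) (W : {W : Set Y // W ∈ 𝓝 0}), ∃ W' : {W : Set Y // W ∈ 𝓝 0},
      W'.1 ⊆ P n ∧ (∀ x ∈ W'.1, -x ∈ W'.1) ∧ ∀ x ∈ W'.1, ∀ y ∈ W'.1, x + y ∈ W.1 := by
    rintro n ⟨W, hW⟩
    obtain ⟨W₁, hW₁, hadd⟩ := exists_nhds_zero_half hW
    have hN : W₁ ∩ P n ∈ 𝓝 (0 : Y) := inter_mem hW₁ (hP n)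
    have hneg : -(W₁ ∩ P n) ∈ 𝓝 (0 : Y) := neg_mem_nhds_zero Y hN
    refine ⟨⟨_, inter_mem hN hneg⟩, fun x hx => hx.1.2, fun x hx => ⟨hx.2, ?_⟩,
      fun x hx y hy => hadd _ hx.1.1 _ hy.1.1⟩
    simpa using hx.1
  choose f hf1 hf2 hf3 using step
  -- The recursion starts by halving `univ`, which is no constraint; thus already the zeroth term is
  -- symmetric and refines `P 0`.
  let W : ℕ → {W : Set Y // W ∈ 𝓝 0} :=
    fun n => Nat.rec (f 0 ⟨univ, univ_mem⟩) (fun n W => f (n + 1) W) n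
  refine ⟨fun n => (W n).1, fun n => (W n).2, fun n => ?_, fun n => ?_, fun n => hf3 (n + 1) (W n)⟩
  · cases n with
    | zero => exact hf1 _ _
    | succ n => exact hf1 (n + 1) (W n)
  · cases n with
    | zero => exact hf2 _ _
    | succ n => exact hf2 (n + 1) (W n)

/-- The quotient of a complete abelian group by a feathered subgroup is complete. -/
theorem completeSpace_quotient_of_isFeathered [CompleteSpace Y] (hH : IsFeathered H)
    (i : H →+ Y) (hi : IsInducing i) :
    @CompleteSpace (Y ⧸ i.range) (IsTopologicalAddGroup.rightUniformSpace (Y ⧸ i.range)) := by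
  let := IsTopologicalAddGroup.rightUniformSpace (Y ⧸ i.range)
  have := isUniformAddGroup_of_addCommGroup (G := Y ⧸ i.range)
  obtain ⟨V, hV, hVU⟩ := hH
  have hP : ∀ n, ∃ P ∈ 𝓝 (0 : Y), i ⁻¹' P ⊆ V n := fun n => by
    have := hV n
    rwa [hi.nhds_eq_comap, map_zero] at this
  choose P hP hPV using hP
  obtain ⟨W, hW, hWP, hWneg, hWadd⟩ := exists_nhds_zero_seq_add_subset P hP
  have hW0 : ∀ n, (0 : Y) ∈ W n := fun n => mem_of_mem_nhds (hW n)
  have hWmono : Antitone W := antitone_nat_of_succ_le fun n x hx => by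
    simpa using hWadd n x hx 0 (hW0 _)
  let q : Y →+ Y ⧸ i.range := QuotientAddGroup.mk' i.range
  have hq : IsOpenQuotientMap q := QuotientAddGroup.isOpenQuotientMap_mk
  have hqnhds : ∀ U ∈ 𝓝 (0 : Y), q '' U ∈ 𝓝 (0 : Y ⧸ i.range) := fun U hU => by
    simpa using hq.isOpenMap.image_mem_nhds hU
  refine ⟨fun {f} hf => ?_⟩
  have := hf.1
  have hf' := (cauchy_iff_exists_sub_mem.1 hf).2
  choose S₀ hS₀ hS₀W using fun n => hf' _ (hqnhds _ (hW n))
  -- Finite intersections make the sets decreasing, so that a point of `S (n + 1)` can be compared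
  -- with one of `S n`.
  let S : ℕ → Set (Y ⧸ i.range) := fun n => ⋂ k ∈ Iic n, S₀ k
  have hS : ∀ n, S n ∈ f := fun n => (biInter_mem (finite_Iic n)).2 fun k _ => hS₀ k
  have hSmono : ∀ n, S (n + 1) ⊆ S n := fun n =>
    biInter_subset_biInter_left (Iic_subset_Iic.2 n.le_succ)
  have hSW : ∀ n, ∀ x ∈ S n, ∀ y ∈ S n, y - x ∈ q '' W n := fun n x hx y hy =>
    hS₀W n x (mem_iInter₂.1 hx n (mem_Iic.2 le_rfl)) y (mem_iInter₂.1 hy n (mem_Iic.2 le_rfl))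
  -- lifts of approximate limits of `f`, forming a Cauchy sequence for the `W n`
  have step : ∀ (n : ℕ) (y : Y), ∃ y', q y ∈ S n → q y' ∈ S (n + 1) ∧ y' - y ∈ W n := by
    intro n y
    by_cases hy : q y ∈ S n
    · obtain ⟨g, hg⟩ := hf.1.nonempty_of_mem (hS (n + 1))
      obtain ⟨w, hw, hwg⟩ := hSW n _ hy g (hSmono n hg)
      refine ⟨y + w, fun _ => ⟨?_, by simpa using hw⟩⟩
      rw [map_add, hwg]
      simpa using hg
    · exact ⟨y, fun h => absurd h hy⟩
  choose next hnext using step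
  obtain ⟨g₀, hg₀⟩ := hf.1.nonempty_of_mem (hS 0)
  obtain ⟨y₀, rfl⟩ := hq.surjective g₀
  let y : ℕ → Y := fun n => Nat.rec y₀ next n
  -- This invariant discharges the hypothesis under which `next` is meaningful.
  have hyS : ∀ n, q (y n) ∈ S n := by
    intro n
    induction n with
    | zero => exact hg₀
    | succ n ih => exact (hnext n (y n) ih).1
  have hyW : ∀ n, y (n + 1) - y n ∈ W n := fun n => (hnext n (y n) (hyS n)).2
  -- The first increment is split off, and the rest is the case `n + 1`; hence `n` stays general in
  -- the induction.
  have hyW' : ∀ k n, y (n + 1 + k) - y (n + 1) ∈ W n := by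
    intro k
    induction k with
    | zero => intro n; simpa using hW0 n
    | succ k ih =>
      intro n
      have h := hWadd n _ (ih (n + 1)) _ (hyW (n + 1))
      rw [sub_add_sub_cancel] at h
      rwa [show n + 1 + (k + 1) = n + 1 + 1 + k by omega]
  -- Points of `Y` close to all terms of the lifted sequence. The shift by two pays for two
  -- additions: telescoping from `y (n + 2)` costs one, adding the correction `w` the other.
  let B : ℕ → Set Y := fun N => {z | ∀ n ≤ N, z - y (n + 2) ∈ W n}
  have hB : Antitone B := fun M N h z hz n hn => hz n (hn.trans h)
  have hne : (comap q f ⊓ ⨅ N, 𝓟 (B N)).NeBot := by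
    rw [(f.basis_sets.comap q).inf_basis_neBot_iff (hasBasis_iInf_principal hB.directed_ge)]
    rintro T hT N -
    obtain ⟨g, hgT, hgS⟩ := hf.1.nonempty_of_mem (inter_mem hT (hS (N + 2)))
    obtain ⟨w, hw, hwg⟩ := hSW _ _ (hyS (N + 2)) g hgS
    refine ⟨y (N + 2) + w, ?_, fun n hn => ?_⟩
    · change q (y (N + 2) + w) ∈ T
      rw [map_add, hwg]
      simpa using hgT
    · have h1 : y (N + 2) - y (n + 2) ∈ W (n + 1) := by
        have := hyW' (N - n) (n + 1)
        rwa [show n + 1 + 1 + (N - n) = N + 2 by omega] at this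
      have := hWadd n _ h1 w (hWmono (by omega) hw)
      rwa [show y (N + 2) + w - y (n + 2) = y (N + 2) - y (n + 2) + w by abel]
  -- The lifted filter is controlled only up to elements of `H`; passing to an ultrafilter decides
  -- among the finitely many translates by which these are covered.
  let F : Ultrafilter Y := Ultrafilter.of (comap q f ⊓ ⨅ N, 𝓟 (B N))
  have hF : (F : Filter Y) ≤ comap q f ⊓ ⨅ N, 𝓟 (B N) := Ultrafilter.of_le _
  have hFf : Tendsto q F f := tendsto_iff_comap.2 (hF.trans inf_le_left)
  have hFB : ∀ n, B n ∈ (F : Filter Y) := fun n =>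
    (hF.trans inf_le_right) (mem_iInf_of_mem n (mem_principal_self _))
  have hFc : Cauchy (F : Filter Y) := by
    refine cauchy_of_exists_translate_mem fun U hU => ?_
    obtain ⟨U₁, hU₁, hadd⟩ := exists_nhds_zero_half hU
    obtain ⟨n, A, hA, hVA⟩ := hVU (i ⁻¹' U₁) (by
      rw [hi.nhds_eq_comap, map_zero]; exact preimage_mem_comap hU₁)
    -- Differences in `T` lift to elements `w` of both `U₁` and `W (n + 1)`: the former for the
    -- final estimate, the latter to force the `H`-part of a difference into `V n`.
    obtain ⟨T, hT, hTU⟩ := hf' _ (hqnhds _ (inter_mem hU₁ (hW (n + 1))))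
    have hmem := inter_mem (mem_map.1 (hFf hT)) (hFB (n + 2))
    obtain ⟨z, hzT, hzB⟩ := F.neBot.nonempty_of_mem hmem
    have hcover : (⋃ a ∈ A, {x | x - (z + i a) ∈ U}) ∈ F := by
      refine mem_of_superset hmem ?_
      rintro x ⟨hxT, hxB⟩
      obtain ⟨w, ⟨hwU, hwW⟩, hw⟩ := hTU _ hzT _ hxT
      obtain ⟨h, hh⟩ : x - z - w ∈ i.range := by
        rw [← QuotientAddGroup.eq_zero_iff]
        change q (x - z - w) = 0
        rw [map_sub, map_sub, hw, sub_self]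
      -- Both points are within `W (n + 2)` of `y (n + 4)`.
      have hxz : x - z ∈ W (n + 1) := by
        have := hWadd _ _ (hxB (n + 2) le_rfl) _ (hWneg _ _ (hzB (n + 2) le_rfl))
        simpa using this
      have hhV : h ∈ V n := by
        apply hPV
        apply hWP
        rw [hh, sub_eq_add_neg]
        exact hWadd _ _ hxz _ (hWneg _ _ hwW)
      obtain ⟨a, ha, haU⟩ := hVA h hhV
      refine mem_iUnion₂.2 ⟨a, ha, ?_⟩
      have haU' : i h - i a ∈ U₁ := by rw [← map_sub]; exact haU
      have := hadd _ hwU _ haU'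
      rw [hh] at this
      change x - (z + i a) ∈ U
      convert this using 1
      abel
    obtain ⟨a, -, ha⟩ := (Ultrafilter.finite_biUnion_mem_iff hA).1 hcover
    exact ⟨_, ha⟩
  obtain ⟨l, hl⟩ := CompleteSpace.complete hFc
  -- The image of `F` is finer than `f` and converges to `q l`, so `q l` is a cluster point of the
  -- Cauchy filter `f`.
  refine ⟨q l, le_nhds_of_cauchy_adhp hf ?_⟩
  have h1 : map q (F : Filter Y) ≤ 𝓝 (q l) := (map_mono hl).trans hq.continuous.continuousAt
  exact ClusterPt.of_le_nhds h1 |>.mono hFf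

end Quotient

/-! ### Čech-complete groups are feathered and complete -/

section CechComplete

theorem IsCechComplete.exists_open {H : Type*} [TopologicalSpace H] (hH : IsCechComplete H) :
    ∃ O : ℕ → Set (StoneCech H), (∀ n, IsOpen (O n)) ∧
      range (stoneCechUnit : H → StoneCech H) = ⋂ n, O n :=
  hH.2.eq_iInter_nat

/-- Neighbourhoods whose closures in the compactification lie in the `O n` trap the limits of
ultrafilters inside `⋂ n, O n`, that is, inside `H`. Were no neighbourhood covered by finitely many
translates of `U`, an ultrafilter could avoid all these translates and still converge. -/
theorem IsCechComplete.isFeathered {H : Type*} [AddCommGroup H] [TopologicalSpace H]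
    [IsTopologicalAddGroup H] (hH : IsCechComplete H) : IsFeathered H := by
  have := hH.1
  obtain ⟨O, hO, hrange⟩ := hH.exists_open
  let e : H → StoneCech H := stoneCechUnit
  have hV : ∀ n, ∃ V ∈ 𝓝 (0 : H), closure (e '' V) ⊆ O n := by
    intro n
    have : O n ∈ 𝓝 (e 0) := (hO n).mem_nhds (by
      have : e 0 ∈ range e := mem_range_self _
      exact mem_iInter.1 (hrange ▸ this) n)
    obtain ⟨C, hC, hCc, hCO⟩ := exists_mem_nhds_isClosed_subset this
    refine ⟨e ⁻¹' C, continuous_stoneCechUnit.continuousAt.preimage_mem_nhds hC, ?_⟩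
    exact (closure_minimal (image_preimage_subset _ _) hCc).trans hCO
  choose V₀ hV₀ hV₀O using hV
  have hconv : ∀ F : Ultrafilter H, (∀ n, V₀ n ∈ F) → ∃ k, (F : Filter H) ≤ 𝓝 k := by
    intro F hF
    obtain ⟨p, hp⟩ : ∃ p, ((F.map e : Ultrafilter _) : Filter (StoneCech H)) ≤ 𝓝 p :=
      ⟨_, (F.map e).le_nhds_lim⟩
    have hpO : p ∈ ⋂ n, O n := mem_iInter.2 fun n => hV₀O n <|
      mem_closure_of_tendsto (b := (F : Filter H)) (f := e) hp
        (mem_of_superset (hF n) fun x hx => mem_image_of_mem e hx)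
    rw [← hrange] at hpO
    obtain ⟨k, rfl⟩ := hpO
    refine ⟨k, ?_⟩
    rw [isInducing_stoneCechUnit.nhds_eq_comap]
    exact tendsto_iff_comap.1 hp
  let V : ℕ → Set H := fun n => ⋂ k ∈ Iic n, V₀ k
  refine ⟨V, fun n => (biInter_mem (finite_Iic n)).2 fun k _ => hV₀ k, fun U hU => ?_⟩
  by_contra! hcon
  -- What remains of `V n` after removing finitely many translates of `U`; nonempty by `hcon`.
  let B : ℕ × Finset H → Set H := fun t => {x | x ∈ V t.1 ∧ ∀ a ∈ t.2, x - a ∉ U}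
  have hB : Directed (· ≥ ·) fun t => 𝓟 (B t) := by
    classical
    rintro ⟨m, A⟩ ⟨n, A'⟩
    refine ⟨(max m n, A ∪ A'), principal_mono.2 fun x hx => ?_, principal_mono.2 fun x hx => ?_⟩
    · exact ⟨biInter_subset_biInter_left (Iic_subset_Iic.2 (le_max_left m n)) hx.1,
        fun a ha => hx.2 a (Finset.mem_union_left _ ha)⟩
    · exact ⟨biInter_subset_biInter_left (Iic_subset_Iic.2 (le_max_right m n)) hx.1,
        fun a ha => hx.2 a (Finset.mem_union_right _ ha)⟩
  have : (⨅ t, 𝓟 (B t)).NeBot := iInf_neBot_of_directed' hB fun t => by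
    obtain ⟨x, hx, hxA⟩ := hcon t.1 t.2 t.2.finite_toSet
    exact principal_neBot_iff.2 ⟨x, hx, hxA⟩
  let F : Ultrafilter H := Ultrafilter.of (⨅ t, 𝓟 (B t))
  have hF : ∀ t, B t ∈ F := fun t =>
    Ultrafilter.of_le (⨅ t, 𝓟 (B t)) (mem_iInf_of_mem t (mem_principal_self _))
  obtain ⟨k, hk⟩ := hconv F fun n =>
    mem_of_superset (hF (n, ∅)) fun x hx => mem_iInter₂.1 hx.1 n (mem_Iic.2 le_rfl)
  have hkU : {x | x - k ∈ U} ∈ F := hk <|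
    (continuous_id.sub continuous_const).continuousAt.preimage_mem_nhds (by simpa using hU)
  -- The translate of `U` at the limit `k` is both in `F` and avoided by `F`; the index `0` is
  -- arbitrary.
  obtain ⟨x, hx, hx'⟩ := F.neBot.nonempty_of_mem (inter_mem hkU (hF (0, {k})))
  exact hx'.2 k (Finset.mem_singleton_self k) hx

/-- A Čech-complete space is a `G_δ` in every Tychonoff space in which it is densely embedded. -/
theorem IsCechComplete.isGδ_range {H C : Type*} [TopologicalSpace H] [TopologicalSpace C]
    [T35Space C] (hH : IsCechComplete H) {j : H → C} (hj : IsInducing j) (hd : DenseRange j) :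
    IsGδ (range j) := by
  have := hH.1
  obtain ⟨O, hO, hrange⟩ := hH.exists_open
  have hc : Continuous fun h => (stoneCechUnit (j h) : StoneCech C) :=
    continuous_stoneCechUnit.comp hj.continuous
  let f : StoneCech H → StoneCech C := stoneCechExtend hc
  have hf : Continuous f := continuous_stoneCechExtend hc
  have hfe : ∀ h, f (stoneCechUnit h) = stoneCechUnit (j h) := stoneCechExtend_stoneCechUnit hc
  have hsurj : Function.Surjective f := by
    have h1 : DenseRange (stoneCechUnit ∘ j : H → StoneCech C) :=
      denseRange_stoneCechUnit.comp hd continuous_stoneCechUnit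
    have h2 : DenseRange f := h1.mono (by rintro _ ⟨h, rfl⟩; exact ⟨_, hfe h⟩)
    rw [← range_eq_univ, ← h2.closure_range]
    exact (isCompact_range hf).isClosed.closure_eq.symm
  -- the remainder of `H` is mapped to the remainder of `j H`
  have hrem : ∀ p h, f p = stoneCechUnit (j h) → p ∈ range (stoneCechUnit : H → StoneCech H) := by
    intro p h hp
    have : (comap (stoneCechUnit : H → StoneCech H) (𝓝 p)).NeBot :=
      isDenseInducing_stoneCechUnit.comap_nhds_neBot p
    let F := comap (stoneCechUnit : H → StoneCech H) (𝓝 p)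
    have h1 : Tendsto (fun x => (stoneCechUnit (j x) : StoneCech C)) F (𝓝 (stoneCechUnit (j h))) := by
      rw [← hp]
      exact ((hf.tendsto p).comp tendsto_comap).congr hfe
    -- The composite of `j` with the unit of `C` is inducing, so convergence of the images gives
    -- convergence in `H`.
    have h2 : F ≤ 𝓝 h := by
      rw [((isInducing_stoneCechUnit (X := C)).comp hj).nhds_eq_comap]
      exact tendsto_iff_comap.1 h1
    exact ⟨h, tendsto_nhds_unique ((continuous_stoneCechUnit.tendsto h).mono_left h2)
      tendsto_comap⟩
  have : range j = ⋂ n, (stoneCechUnit : C → StoneCech C) ⁻¹' (f '' (O n)ᶜ)ᶜ := by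
    ext c
    simp only [mem_iInter, mem_preimage, mem_compl_iff]
    constructor
    · rintro ⟨h, rfl⟩ n ⟨p, hp, hpj⟩
      have := hrem p h hpj
      rw [hrange] at this
      exact hp (mem_iInter.1 this n)
    · intro hcn
      obtain ⟨p, hp⟩ := hsurj (stoneCechUnit c)
      have : p ∈ ⋂ n, O n := mem_iInter.2 fun n => by
        by_contra hn
        exact hcn n ⟨p, hn, hp⟩
      rw [← hrange] at this
      obtain ⟨h, rfl⟩ := this
      exact ⟨h, injective_stoneCechUnit_of_t35Space ((hfe h).symm.trans hp)⟩
  rw [this]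
  refine IsGδ.iInter_of_isOpen fun n => IsOpen.preimage continuous_stoneCechUnit ?_
  exact ((hO n).isClosed_compl.isCompact.image hf).isClosed.isOpen_compl

/-- A dense `G_δ` in a compact Hausdorff space is Baire. -/
theorem IsCechComplete.baireSpace {H : Type*} [TopologicalSpace H] (hH : IsCechComplete H) :
    BaireSpace H := by
  have := hH.1
  have := hH.2.baireSpace_of_dense denseRange_stoneCechUnit
  exact (isEmbedding_stoneCechUnit (X := H)).toHomeomorph.symm.baireSpace

/-- A Čech-complete topological abelian group is complete. -/
theorem IsCechComplete.completeSpace {H : Type*} [AddCommGroup H] [UniformSpace H]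
    [IsUniformAddGroup H] (hH : IsCechComplete H) : CompleteSpace H := by
  have := hH.1
  have := hH.baireSpace
  let C := UniformSpace.Completion H
  let j : H →+ C := UniformSpace.Completion.toCompl
  have hj : IsDenseInducing j := UniformSpace.Completion.isDenseInducing_toCompl H
  have : T35Space C := {}
  obtain ⟨W, hW, hWr⟩ := (hH.isGδ_range hj.isInducing hj.dense).eq_iInter_nat
  have hsurj : Function.Surjective j := by
    intro y
    -- The reflection of the dense `G_δ` set `range j` in `y` meets `range j` by Baire category in
    -- `H`; a common point exhibits `y` as a sum of two elements of `range j`.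
    have hdense : Dense (⋂ n, {h | y - j h ∈ W n}) := by
      refine dense_iInter_of_isOpen_nat
        (fun n => (hW n).preimage (continuous_const.sub hj.continuous)) fun n => ?_
      have hWd : Dense (W n) := hj.dense.mono (hWr ▸ iInter_subset W n)
      rw [dense_iff_inter_open]
      rintro o ho ⟨x, hx⟩
      obtain ⟨o', ho', rfl⟩ := hj.isInducing.isOpen_iff.1 ho
      have h1 : IsOpen ((fun c => y - c) ⁻¹' o') := ho'.preimage (continuous_const.sub continuous_id)
      obtain ⟨c, hc, hcW⟩ := hWd.inter_open_nonempty _ h1 ⟨y - j x, by simpa using hx⟩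
      have h2 : IsOpen (o' ∩ (fun c => y - c) ⁻¹' W n) :=
        ho'.inter ((hW n).preimage (continuous_const.sub continuous_id))
      -- Both conditions hold at `y - c` and are open, so it may be replaced by a nearby point of
      -- `range j`.
      obtain ⟨h, hh⟩ := hj.dense.exists_mem_open h2 ⟨y - c, hc, by simpa using hcW⟩
      exact ⟨h, hh.1, hh.2⟩
    obtain ⟨h, hh⟩ := hdense.nonempty
    have : y - j h ∈ range j := by
      rw [hWr]
      exact mem_iInter.2 fun n => mem_iInter.1 hh n
    obtain ⟨k, hk⟩ := this
    exact ⟨k + h, by rw [map_add, hk, sub_add_cancel]⟩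
  have hu : IsUniformInducing j := UniformSpace.Completion.isUniformInducing_coe H
  exact (hu.completeSpace_congr hsurj).2 inferInstance

end CechComplete

/-! ### Extending homomorphisms from dense subgroups -/

theorem Topology.IsInducing.isUniformInducing_addMonoidHom {A B : Type*}
    [AddCommGroup A] [UniformSpace A] [IsUniformAddGroup A]
    [AddCommGroup B] [UniformSpace B] [IsUniformAddGroup B] {j : A →+ B} (hj : IsInducing j) :
    IsUniformInducing j := by
  refine ⟨?_⟩
  -- Both uniformities are pulled back from zero along the difference map, with which `j` commutes.
  rw [uniformity_eq_comap_nhds_zero, uniformity_eq_comap_nhds_zero,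
    hj.nhds_eq_comap, map_zero, comap_comap, comap_comap]
  congr 1
  ext x
  simp

section Extend

variable {A B C : Type*} [AddCommGroup A] [TopologicalSpace A] [IsTopologicalAddGroup A]
  [AddCommGroup B] [TopologicalSpace B] [IsTopologicalAddGroup B]
  [AddCommGroup C] [TopologicalSpace C] [IsTopologicalAddGroup C]

/-- A continuous homomorphism to a complete Hausdorff group extends from a dense subgroup. -/
theorem exists_continuousAddMonoidHom_extension [T2Space C]
    (hC : @CompleteSpace C (IsTopologicalAddGroup.rightUniformSpace C))
    {j : A →+ B} (hj : IsDenseInducing j) (f : A →+ C) (hf : Continuous f) :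
    ∃ g : B →ₜ+ C, ∀ a, g (j a) = f a := by
  let := IsTopologicalAddGroup.rightUniformSpace A
  have := isUniformAddGroup_of_addCommGroup (G := A)
  let := IsTopologicalAddGroup.rightUniformSpace B
  have := isUniformAddGroup_of_addCommGroup (G := B)
  let := IsTopologicalAddGroup.rightUniformSpace C
  have := isUniformAddGroup_of_addCommGroup (G := C)
  have hju := hj.isInducing.isUniformInducing_addMonoidHom
  have hfu : UniformContinuous f := uniformContinuous_addMonoidHom_of_continuous hf
  let g : B → C := hj.extend f
  have hg : Continuous g := (uniformContinuous_uniformly_extend hju hj.dense hfu).continuous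
  have hgj : ∀ a, g (j a) = f a := fun a => hj.extend_eq hf a
  have hadd : ∀ x y, g (x + y) = g x + g y := fun x y => by
    refine hj.dense.induction_on₂ (p := fun x y => g (x + y) = g x + g y) ?_ ?_ x y
    · exact isClosed_eq (hg.comp (continuous_fst.add continuous_snd))
        ((hg.comp continuous_fst).add (hg.comp continuous_snd))
    · intro a b
      rw [← map_add, hgj, hgj, hgj, map_add]
  exact ⟨{ toAddMonoidHom := AddMonoidHom.mk' g hadd, continuous_toFun := hg }, hgj⟩

/-- A complete group is closed in any Hausdorff group in which it embeds. -/
theorem isClosed_range_of_completeSpace [T2Space B]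
    (hA : @CompleteSpace A (IsTopologicalAddGroup.rightUniformSpace A))
    {j : A →+ B} (hj : IsInducing j) : IsClosed (range j) := by
  let := IsTopologicalAddGroup.rightUniformSpace A
  have := isUniformAddGroup_of_addCommGroup (G := A)
  let := IsTopologicalAddGroup.rightUniformSpace B
  have := isUniformAddGroup_of_addCommGroup (G := B)
  exact hj.isUniformInducing_addMonoidHom.isComplete_range.isClosed

end Extend

/-! ### The completion as a complete group with a dense subgroup -/

namespace GroupCompletion

variable (G : Type u) [AddCommGroup G] [TopologicalSpace G] [IsTopologicalAddGroup G]

theorem isDenseInducing_incl : IsDenseInducing (incl G : G →+ GroupCompletion G) :=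
  let := IsTopologicalAddGroup.rightUniformSpace G
  have := isUniformAddGroup_of_addCommGroup (G := G)
  UniformSpace.Completion.isDenseInducing_toCompl G

theorem completeSpace_rightUniformSpace : @CompleteSpace (GroupCompletion G)
    (IsTopologicalAddGroup.rightUniformSpace (GroupCompletion G)) := by
  rw [IsUniformAddGroup.rightUniformSpace_eq]
  infer_instance

end GroupCompletion

theorem IsCechComplete.completeSpace_rightUniformSpace {H : Type*} [AddCommGroup H]
    [TopologicalSpace H] [IsTopologicalAddGroup H] (hH : IsCechComplete H) :
    @CompleteSpace H (IsTopologicalAddGroup.rightUniformSpace H) :=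
  let := IsTopologicalAddGroup.rightUniformSpace H
  have := isUniformAddGroup_of_addCommGroup (G := H)
  hH.completeSpace

/-! ### Pull-backs along dense inclusions -/

namespace TopExtension

variable {G : Type u} {H : Type v} [AddCommGroup G] [TopologicalSpace G]
  [IsTopologicalAddGroup G] [T2Space G]
  [AddCommGroup H] [TopologicalSpace H] [IsTopologicalAddGroup H] [T2Space H]

section Pullback

variable {Y : Type u} [AddCommGroup Y] [TopologicalSpace Y] [IsTopologicalAddGroup Y] [T2Space Y]

/-- The canonical map from the middle group of a pull-back to that of the extension. -/
def fromPullback (E : TopExtension G H) (t : Y →ₜ+ G) : (E.pullback t).X →ₜ+ E.X where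
  toAddMonoidHom := (AddMonoidHom.fst E.X Y).comp (E.pullbackSubgroup t).subtype
  continuous_toFun := continuous_fst.comp continuous_subtype_val

theorem π_fromPullback (E : TopExtension G H) (t : Y →ₜ+ G) (x : (E.pullback t).X) :
    E.π (E.fromPullback t x) = t ((E.pullback t).π x) := x.2

/-- In a pair `(x, y)` of the pull-back, `t y = π x`; as `t` is inducing, the topology seen by `y`
is already determined by `x`. The range is the preimage under `π` of the range of `t`, and preimages
of dense sets under open maps are dense. -/
theorem isDenseInducing_fromPullback (E : TopExtension G H) {t : Y →ₜ+ G}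
    (ht : IsDenseInducing t) :
    IsDenseInducing (E.fromPullback t : (E.pullback t).X →+ E.X) := by
  refine ⟨⟨?_⟩, ?_⟩
  · change TopologicalSpace.induced (fun z : E.pullbackSubgroup t => z.1)
      (TopologicalSpace.induced Prod.fst _ ⊓ TopologicalSpace.induced Prod.snd _) =
      TopologicalSpace.induced (fun z : E.pullbackSubgroup t => z.1.1) _
    rw [induced_inf, induced_compose, induced_compose]
    refine inf_eq_left.2 ?_
    have h : (t ∘ Prod.snd ∘ fun z : E.pullbackSubgroup t => z.1) =
        E.π ∘ (fun z : E.pullbackSubgroup t => z.1.1) := funext fun z => z.2.symm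
    refine le_of_le_of_eq ?_ ((congrArg (TopologicalSpace.induced _)
      ht.isInducing.eq_induced).trans induced_compose).symm
    rw [h]
    exact (induced_mono E.π_continuous.le_induced).trans_eq induced_compose
  · have hd := ht.dense.preimage E.isSES.isOpenQuotientMap.isOpenMap
    refine hd.mono ?_
    rintro x ⟨y, hy⟩
    exact ⟨⟨(x, y), hy.symm⟩, rfl⟩

theorem baerSum_pullback (E₁ E₂ : TopExtension G H) (t : Y →ₜ+ G) :
    ((E₁.pullback t).baerSum (E₂.pullback t)).Equivalent ((E₁.baerSum E₂).pullback t) := by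
  let P := (E₁.pullback t).fiberProd (E₂.pullback t)
  let q₁ : P.X →ₜ+ E₁.X := (E₁.fromPullback t).comp (fiberFst _ _)
  let q₂ : P.X →ₜ+ E₂.X := (E₂.fromPullback t).comp (fiberSnd _ _)
  have h₁ : ∀ x, E₁.π (q₁ x) = t (P.π x) := fun x =>
    (E₁.π_fromPullback t _).trans (congrArg t (π_fiberFst x))
  have h₂ : ∀ x, E₂.π (q₂ x) = t (P.π x) := fun x =>
    (E₂.π_fromPullback t _).trans (congrArg t (π_fiberSnd x))
  let T : P.X →ₜ+ (E₁.baerSum E₂).X :=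
    (toBaerSum E₁ E₂).comp (fiberLift q₁ q₂ fun x => (h₂ x).trans (h₁ x).symm)
  refine baerSum_equivalent
    { toAddMonoidHom := ((T : P.X →+ (E₁.baerSum E₂).X).prod P.π).codRestrict
        ((E₁.baerSum E₂).pullbackSubgroup t) h₁
      continuous_toFun := Continuous.subtype_mk (T.continuous_toFun.prodMk P.π_continuous) _ }
    (fun a b => ?_) fun x => rfl
  refine Subtype.ext (Prod.ext ?_ (P.π_ι (a, b)))
  change toBaerSum E₁ E₂ (fiberLift _ _ _ _) = _
  rw [fiberLift_eq_ι (h₁ := a) (h₂ := b) rfl rfl, toBaerSum_ι]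
  rfl

/-- An extension by a complete group is trivial if its restriction to a dense subgroup of the base
is. -/
theorem equivalent_trivial_of_pullback
    (hH : @CompleteSpace H (IsTopologicalAddGroup.rightUniformSpace H))
    (E : TopExtension G H) {t : Y →ₜ+ G} (ht : IsDenseInducing t)
    (h : (E.pullback t).Equivalent (trivial Y H)) : E.Equivalent (trivial G H) := by
  obtain ⟨T, h1, h2⟩ := h
  let T' : (E.pullback t).X →ₜ+ H × Y := T
  -- The `H`-component of a splitting is a retraction onto `H`. Its extension `r` is still one,
  -- since `H` already lies in the dense subgroup.
  obtain ⟨r, hr⟩ := exists_continuousAddMonoidHom_extension hH (E.isDenseInducing_fromPullback ht)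
    ((AddMonoidHom.fst H Y).comp (T' : (E.pullback t).X →+ H × Y))
    (continuous_fst.comp T'.continuous_toFun)
  refine ⟨{ toAddMonoidHom := (r : E.X →+ H).prod E.π
            continuous_toFun := r.continuous_toFun.prodMk E.π_continuous },
    fun h => Prod.ext ?_ (E.π_ι h), fun x => rfl⟩
  exact (hr ((E.pullback t).ι h)).trans (congrArg Prod.fst (h1 h))

end Pullback

/-- An extension by a Čech-complete group extends to the completion of the base, by completing the
middle group. -/
theorem exists_pullback_incl_equivalent (hH : IsCechComplete H) (E : TopExtension G H) :
    ∃ F : TopExtension (GroupCompletion G) H,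
      E.Equivalent (F.pullback (GroupCompletion.incl G)) := by
  let j : E.X →+ GroupCompletion E.X := GroupCompletion.incl E.X
  have hj : IsDenseInducing j := GroupCompletion.isDenseInducing_incl E.X
  let k : G →+ GroupCompletion G := GroupCompletion.incl G
  have hk : IsDenseInducing k := GroupCompletion.isDenseInducing_incl G
  let i : H →+ GroupCompletion E.X := j.comp E.ι
  have hi : IsInducing i := hj.isInducing.comp E.isSES.isClosedEmbedding.isInducing
  have hi_inj : Function.Injective i := hj.injective.comp E.ι_injective
  have hicl : IsClosed (i.range : Set (GroupCompletion E.X)) := by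
    rw [AddMonoidHom.coe_range]
    exact isClosed_range_of_completeSpace hH.completeSpace_rightUniformSpace hi
  have hQ := completeSpace_quotient_of_isFeathered hH.isFeathered i hi
  let q : GroupCompletion E.X →+ GroupCompletion E.X ⧸ i.range := QuotientAddGroup.mk' i.range
  have hq : IsOpenQuotientMap q := QuotientAddGroup.isOpenQuotientMap_mk
  obtain ⟨p, hp⟩ := exists_continuousAddMonoidHom_extension
    (GroupCompletion.completeSpace_rightUniformSpace G) hj (k.comp E.π)
    (hk.continuous.comp E.π_continuous)
  have hpi : ∀ h, p (i h) = 0 := fun h => (hp (E.ι h)).trans (by simp [E.π_ι])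
  let p' : GroupCompletion E.X ⧸ i.range →+ GroupCompletion G :=
    QuotientAddGroup.lift i.range (p : GroupCompletion E.X →+ GroupCompletion G)
      (by rintro _ ⟨h, rfl⟩; exact hpi h)
  have hp' : Continuous p' := p.continuous_toFun.quotient_lift _
  -- the section of `p'`, extended from `G`
  let s₀ : G →+ GroupCompletion E.X ⧸ i.range :=
    E.π.liftOfSurjective E.π_surjective ⟨q.comp j, fun x hx => by
      obtain ⟨h, rfl⟩ := E.exists_ι hx
      exact (QuotientAddGroup.eq_zero_iff _).2 ⟨h, rfl⟩⟩
  have hs₀ : ∀ x, s₀ (E.π x) = q (j x) := fun x =>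
    AddMonoidHom.liftOfRightInverse_comp_apply _ _ _ _ x
  have hs₀c : Continuous s₀ := by
    rw [E.isSES.isOpenQuotientMap.isQuotientMap.continuous_iff]
    exact (hq.continuous.comp hj.continuous).congr fun x => (hs₀ x).symm
  -- Closedness of `H` makes the quotient Hausdorff, as needed to extend `s₀` and to compare maps on
  -- dense subgroups.
  have : T3Space (GroupCompletion E.X ⧸ i.range) := by
    have := hicl
    infer_instance
  obtain ⟨s, hs⟩ := exists_continuousAddMonoidHom_extension hQ hk s₀ hs₀c
  have hps : ∀ y, p' (s y) = y := congrFun <| hk.dense.equalizer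
    (hp'.comp s.continuous_toFun) continuous_id <| funext fun g => by
      obtain ⟨x, rfl⟩ := E.π_surjective g
      change p' (s (k (E.π x))) = k (E.π x)
      rw [hs, hs₀]
      exact hp x
  have hsp : ∀ y, s (p y) = q y := congrFun <| hj.dense.equalizer
    (s.continuous_toFun.comp p.continuous_toFun) hq.continuous <| funext fun x => by
      change s (p (j x)) = q (j x)
      rw [hp, ← hs₀]
      exact hs _
  have hsp' : ∀ z, s (p' z) = z := fun z => by
    obtain ⟨y, rfl⟩ := hq.surjective z
    exact hsp y
  let e : (GroupCompletion E.X ⧸ i.range) ≃ₜ GroupCompletion G :=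
    { toFun := p'
      invFun := s
      left_inv := hsp'
      right_inv := hps
      continuous_toFun := hp'
      continuous_invFun := s.continuous_toFun }
  -- Openness of `p` is the point that needs the quotient to be complete: `p` is `q` followed by a
  -- homeomorphism.
  have hpo : IsOpenQuotientMap (p : GroupCompletion E.X →+ GroupCompletion G) :=
    e.isOpenQuotientMap.comp hq
  let F : TopExtension (GroupCompletion G) H :=
    { X := GroupCompletion E.X
      ι := i
      π := p
      isSES := isSES_of_isInducing hi_inj hi hpo fun y => by
        constructor
        · intro hy
          have := hsp y
          rw [show p y = 0 from hy, map_zero] at this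
          exact (QuotientAddGroup.eq_zero_iff y).1 this.symm
        · rintro ⟨h, rfl⟩
          exact hpi h }
  exact ⟨F, equivalent_pullback (E := F) (GroupCompletion.incl E.X) (fun h => rfl) hp⟩

end TopExtension

theorem theorem3p2 (G : Type u) (H : Type v)
    [AddCommGroup G] [TopologicalSpace G] [IsTopologicalAddGroup G] [T2Space G]
    [AddCommGroup H] [TopologicalSpace H] [IsTopologicalAddGroup H] [T2Space H]
    (hH : IsCechComplete H) :
    ∃ φ : TopExt (GroupCompletion G) H ≃+ TopExt G H,
      ∀ e, φ e = TopExt.pullback (GroupCompletion.incl G) e := by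
  let φ : TopExt (GroupCompletion G) H →+ TopExt G H :=
    AddMonoidHom.mk' (TopExt.pullback (GroupCompletion.incl G)) fun a b => by
      induction a using TopExt.ind with | _ E₁
      induction b using TopExt.ind with | _ E₂
      exact (TopExt.mk_eq_mk.2 (TopExtension.baerSum_pullback E₁ E₂ _)).symm
  have hinj : Function.Injective φ := by
    rw [injective_iff_map_eq_zero]
    intro a ha
    induction a using TopExt.ind with | _ E
    -- Zero is by definition the class of the trivial extension, so `ha` amounts to an equivalence
    -- with it.
    exact TopExt.mk_eq_mk.2 <| E.equivalent_trivial_of_pullback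
      hH.completeSpace_rightUniformSpace (GroupCompletion.isDenseInducing_incl G)
      (TopExt.mk_eq_mk.1 ha)
  have hsurj : Function.Surjective φ := by
    intro a
    induction a using TopExt.ind with | _ E
    obtain ⟨F, hF⟩ := E.exists_pullback_incl_equivalent hH
    exact ⟨TopExt.mk F, (TopExt.mk_eq_mk.2 hF).symm⟩
  exact ⟨AddEquiv.ofBijective φ ⟨hinj, hsurj⟩, fun _ => rfl⟩
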